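/- Let $K$ be a non-archimedean local field (a non-discrete locally compact field, of characteristic $0$ or $p$), with ring of integers $\mathcal{O}_K$ and algebraic closure $\overline{K}$. For a finite extension $L/K$ write $\mathcal{O}_L$ for its ring of integers and $k_L$ for its residue field. A rational map over a field $k$ is tamely ramified if none of its ramification indices at points of $\mathbb{P}^1(\bar k)$ is divisible by the characteristic of $k$; constant maps are allowed and nothing is required of them. Let $\varphi=[F:G]$ be a rational map over $K$, where $F,G$ are coprime binary forms of the same degree $d$. An integral model of $\varphi$ over $\mathcal{O}_L$ is a pair of binary forms of degree $d$ with coefficients in $\mathcal{O}_L$, not all in the maximal ideal, that represents $A^{-1}\circ\varphi\circ A$ for some $A\in\mathrm{PGL}_2(L)$. Its reduction is the pair of forms over $k_L$ obtained modulo the maximal ideal. The map $\varphi$ is absolutely tamely ramified if it is tamely ramified and, for every finite extension $L/K$ and every integral model of $\varphi$ over $\mathcal{O}_L$, the map over $k_L$ obtained from the reduction by clearing the common factor of the two forms is tamely ramified. The map $\varphi$ has good reduction if, for some finite extension $L/K$, it has an integral model over $\mathcal{O}_L$ whose reduction is a pair of forms without a common factor. A polynomial $f\in K[z]$ is postcritically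 finite (PCF) if each of its critical points in $\mathbb{P}^1(\overline{K})$ has a finite forward orbit under $f$. Theorem. Let $f\in K[z]$ be an absolutely tamely ramified PCF polynomial of degree $d\ge 2$. Then $f$ has good reduction. -/

import Mathlib

/-!
Rational self-maps of the projective line, given by a pair `(Φ 0, Φ 1)` of binary forms of the same
degree: `[x : y] ↦ [Φ 0 (x, y) : Φ 1 (x, y)]`, with `X 0 = x`, `X 1 = y`, and `∞ = [1 : 0]`.
-/

/-- A pair of polynomials in two variables over `R`. -/
abbrev FormPair (R : Type*) [CommRing R] := Fin 2 → MvPolynomial (Fin 2) R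

namespace FormPair

/-- Change of coefficients along a ring homomorphism. -/
noncomputable def map {R S : Type*} [CommRing R] [CommRing S] (φ : R →+* S) (Φ : FormPair R) :
    FormPair S :=
  fun i => MvPolynomial.map φ (Φ i)

/-- The conjugate `A⁻¹ ∘ Φ ∘ A` of `Φ` by the coordinate change `A`. -/
noncomputable def conj {F : Type*} [Field F] (A : GL (Fin 2) F) (Φ : FormPair F) : FormPair F :=
  fun i => ∑ j, MvPolynomial.C ((A⁻¹).val i j) *
    MvPolynomial.bind₁
      (fun l => ∑ m, MvPolynomial.C (A.val l m) * (MvPolynomial.X m : MvPolynomial (Fin 2) F)) (Φ j)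

/-- The linear form that vanishes exactly at the point `[P 0 : P 1]`. -/
noncomputable def pointForm {F : Type*} [Field F] (P : Fin 2 → F) : MvPolynomial (Fin 2) F :=
  MvPolynomial.C (P 1) * MvPolynomial.X 0 - MvPolynomial.C (P 0) * MvPolynomial.X 1

/-- The binary form whose zeros, with multiplicity, are the fibre of `Φ` through the point `P`. -/
noncomputable def fibreForm {F : Type*} [Field F] (Φ : FormPair F) (P : Fin 2 → F) :
    MvPolynomial (Fin 2) F :=
  MvPolynomial.C (MvPolynomial.eval P (Φ 1)) * Φ 0 -
    MvPolynomial.C (MvPolynomial.eval P (Φ 0)) * Φ 1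

/-- The map given by the pair `Φ` of forms of the same degree without common factor is tamely
ramified: at each geometric point `P`, the ramification index (the order of vanishing at `P` of the
form that cuts out the fibre through `P`) is not divisible by the characteristic of the field.
For a constant map the fibre form is `0`, the order is `⊤`, and nothing is required. -/
def IsTamelyRamified {k : Type*} [Field k] (Φ : FormPair k) : Prop :=
  ∀ P : Fin 2 → AlgebraicClosure k, P ≠ 0 →
    ∀ n : ℕ, emultiplicity (pointForm P)
        (fibreForm (Φ.map (algebraMap k (AlgebraicClosure k))) P) = n →
      (n : k) ≠ 0

/-- The reduction of a pair `Ψ` of forms over a valuation ring modulo the maximal ideal. -/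
noncomputable def reduction {L : Type*} [Field L] {V : ValuationSubring L} (Ψ : FormPair V) :
    FormPair (IsLocalRing.ResidueField V) :=
  Ψ.map (IsLocalRing.residue V)

/-- `Ψ` is an integral model over the valuation ring `V` of the map `Φ`: over the fraction field,
`Ψ` is a conjugate of `Φ`, and it is normalized, i.e. its coefficients are in `V` and not all in
the maximal ideal. -/
def IsIntegralModel {L : Type*} [Field L] {V : ValuationSubring L} (Ψ : FormPair V)
    (Φ : FormPair L) : Prop :=
  (∃ A : GL (Fin 2) L, ∃ c : L, c ≠ 0 ∧
    ∀ i, Ψ.map V.subtype i = MvPolynomial.C c * Φ.conj A i) ∧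
  ∃ i, Ψ.reduction i ≠ 0

/-- The map given by the pair `Ψ` over a field is tamely ramified after the common factor of the two
forms is cleared. -/
def IsTameAfterClearing {k : Type*} [Field k] (Ψ : FormPair k) : Prop :=
  ∀ (H : MvPolynomial (Fin 2) k) (Θ : FormPair k),
    (∀ i, Ψ i = H * Θ i) → IsRelPrime (Θ 0) (Θ 1) → Θ.IsTamelyRamified

end FormPair

/-- `V` is the ring of integers of the finite extension `L` of the local field `K`: the (unique)
valuation ring of `L` that lies over the ring of integers of `K`. -/
def IsIntegersOver (K : Type*) [Field K] [ValuativeRel K] {L : Type*} [Field L] [Algebra K L]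
    (V : ValuationSubring L) : Prop :=
  V.comap (algebraMap K L) = (ValuativeRel.valuation K).valuationSubring

/-- `Φ` is absolutely tamely ramified: it is tamely ramified, and over the ring of integers of each
finite extension of `K`, each integral model of `Φ` has a reduction that is tamely ramified (or
constant) after clearing common factors. -/
def IsAbsolutelyTamelyRamified.{u} {K : Type u} [Field K] [ValuativeRel K] (Φ : FormPair K) : Prop :=
  Φ.IsTamelyRamified ∧
    ∀ (L : Type u) [Field L] [Algebra K L] [FiniteDimensional K L] (V : ValuationSubring L),
      IsIntegersOver K V → ∀ Ψ : FormPair V, Ψ.IsIntegralModel (Φ.map (algebraMap K L)) →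
        Ψ.reduction.IsTameAfterClearing

/-- `Φ` has good reduction, as a conjugacy class over the algebraic closure: over the ring of
integers of some finite extension of `K` it has an integral model whose reduction has no common
factor, i.e. has the same degree as `Φ`. -/
def HasGoodReduction.{u} {K : Type u} [Field K] [ValuativeRel K] (Φ : FormPair K) : Prop :=
  ∃ (L : Type u) (_ : Field L) (_ : Algebra K L) (_ : FiniteDimensional K L)
    (V : ValuationSubring L), IsIntegersOver K V ∧
      ∃ Ψ : FormPair V, Ψ.IsIntegralModel (Φ.map (algebraMap K L)) ∧
        IsRelPrime (Ψ.reduction 0) (Ψ.reduction 1)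

namespace Polynomial

/-- The self-map of the projective line given by a polynomial `f` of degree `d`:
`[x : y] ↦ [y ^ d * f (x / y) : y ^ d]`. -/
noncomputable def toFormPair {K : Type*} [Field K] (f : Polynomial K) : FormPair K :=
  ![∑ i ∈ Finset.range (f.natDegree + 1),
      MvPolynomial.C (f.coeff i) * MvPolynomial.X 0 ^ i * MvPolynomial.X 1 ^ (f.natDegree - i),
    MvPolynomial.X 1 ^ f.natDegree]

/-- `f` is postcritically finite: each critical point has a finite forward orbit. The critical
points in the affine line over the algebraic closure are the zeros of the derivative; the point
`∞` is fixed by `f`, so that its orbit is finite. -/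
def IsPostcriticallyFinite {K : Type*} [Field K] (f : Polynomial K) : Prop :=
  ∀ c : AlgebraicClosure K, aeval c (derivative f) = 0 →
    (Set.range fun n : ℕ => (fun z : AlgebraicClosure K => aeval z f)^[n] c).Finite

end Polynomial

/-!
Let `v` be a valuation of the algebraic closure `F` of `K` that extends the valuation of `K`. Over
`F` write `g = f - X = a ∏ (X - αᵢ)`, a product over the fixed points of `f`, and
`f' = d a ∏ (X - cₖ)`, a product over the critical points; tameness of `f` at `∞` gives `d ≠ 0`
in `K`. Let `ρ` be the largest distance between two fixed points.

If `v a * ρ ^ (d - 1) ≤ 1`, then conjugation by `z ↦ α + b z`, with `α` a fixed point and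
`b ^ (d - 1) = a⁻¹`, turns `f` into a monic polynomial with integral coefficients, and `f` has good
reduction.

Otherwise `f` strictly increases the distance to a fixed point outside the disc of radius `ρ`
spanned by the fixed points (`Polynomial.infinite_orbit_of_lt`), so that postcritical finiteness
gives `v (g cₖ) ≤ ρ` for all `k`. There are `d` fixed points and only one critical point fewer,
and the fixed points lie in at least two residue classes of that disc. By pigeonhole, some class
contains at least as many critical as fixed points. Repeating this inside the class leads to a
fixed point `α` and a radius `s < ρ` such that the disc `D(α, s)` is mapped onto a disc of radius
`ρ > s`, while `|f'| ≤ 1` on `D(α, s)` (`exists_radius_prod_max`).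

Expand `f (α + z) - α = ∑ aⱼ zʲ`. Then `v (j aⱼ) * s ^ (j - 1) ≤ 1` for all `j ≥ 1`, but
`v aⱼ * s ^ (j - 1) > 1` for some `j ≥ 2`. Hence the largest `v b` for which conjugation by
`z ↦ α + b z` makes `f` integral is smaller than `s`. The coefficients `uⱼ = aⱼ b ^ (j - 1)` of this
conjugate are integral, one of them with `j ≥ 2` is a unit, and `v (j uⱼ) < 1` for all `j ≥ 2`.
So the reduction is a polynomial whose degree is at least `2` and vanishes in the residue field:
it is wildly ramified at `∞`, and `f` is not absolutely tamely ramified.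

The argument needs neither completeness nor rank one: all radii are taken in the value group of
`F`, which is divisible.
-/

/-! ### Extension of valuation rings -/

/-- Every valuation ring of a field is induced by a valuation ring of any given extension field. -/
theorem ValuationSubring.exists_comap_algebraMap_eq {K F : Type*} [Field K] [Field F] [Algebra K F]
    (A : ValuationSubring K) : ∃ V : ValuationSubring F, V.comap (algebraMap K F) = A := by
  obtain ⟨V, hV, hloc⟩ :=
    IsLocalRing.exists_factor_valuationRing ((algebraMap K F).comp A.subtype)
  refine ⟨V, ?_⟩
  ext x
  rw [ValuationSubring.mem_comap]
  constructor
  · intro hx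
    rcases A.mem_or_inv_mem x with h | h
    · exact h
    · by_cases hx0 : x = 0
      · rw [hx0]; exact A.zero_mem
      have hu : IsUnit ((((algebraMap K F).comp A.subtype).codRestrict V.toSubring hV)
          (⟨x⁻¹, h⟩ : A)) := by
        refine IsUnit.of_mul_eq_one ⟨algebraMap K F x, hx⟩ ?_
        apply Subtype.ext
        change algebraMap K F x⁻¹ * algebraMap K F x = 1
        rw [← map_mul, inv_mul_cancel₀ hx0, map_one]
      obtain ⟨y, hy⟩ := (hloc.map_nonunit _ hu).exists_right_inv
      have hy' : x⁻¹ * (y : K) = 1 := congrArg Subtype.val hy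
      have : x = y := by
        field_simp at hy'
        exact hy'.symm
      rw [this]; exact y.2
  · exact fun hx => hV ⟨x, hx⟩

/-- An element of the restricted valuation ring has nonzero residue exactly when its value, computed
in the larger field, is `1`. -/
theorem ValuationSubring.residue_comap_ne_zero_iff {L F : Type*} [Field L] [Field F] [Algebra L F]
    (V : ValuationSubring F) (x : V.comap (algebraMap L F)) :
    IsLocalRing.residue _ x ≠ 0 ↔ V.valuation (algebraMap L F x) = 1 := by
  rw [IsLocalRing.residue_ne_zero_iff_isUnit]
  constructor
  · intro h
    obtain ⟨y, hy⟩ := h.exists_right_inv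
    have h1 : V.valuation (algebraMap L F x) * V.valuation (algebraMap L F y) = 1 := by
      rw [← map_mul, ← map_mul]
      have : (x : L) * y = 1 := congrArg Subtype.val hy
      rw [this, map_one, map_one]
    have hx := V.valuation_le_one ⟨_, x.2⟩
    have hy := V.valuation_le_one ⟨_, y.2⟩
    exact hx.antisymm (h1.ge.trans (mul_le_of_le_one_right' hy))
  · intro h
    have hx0 : (x : L) ≠ 0 := by
      intro h0
      simp [h0] at h
    have hy : (x : L)⁻¹ ∈ V.comap (algebraMap L F) := by
      rw [ValuationSubring.mem_comap, ← V.valuation_le_one_iff, map_inv₀, map_inv₀, h, inv_one]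
    exact IsUnit.of_mul_eq_one ⟨_, hy⟩ (Subtype.ext (mul_inv_cancel₀ hx0))

/-! ### Gauss values of polynomials -/

open Polynomial in
/-- `M` is the Gauss value `max_i v (pᵢ) * r ^ i` of the polynomial `p` for the radius `r`, i.e. the
generic value of `p` on the disc of radius `r` about `0`. It is a predicate, so that `r` and `M` may
live in an arbitrary value group. -/
structure IsGaussValue {F Γ : Type*} [Field F] [LinearOrderedCommGroupWithZero Γ]
    (v : Valuation F Γ) (r : Γ) (p : F[X]) (M : Γ) : Prop where
  le : ∀ i, v (p.coeff i) * r ^ i ≤ M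
  exists_eq : ∃ i, v (p.coeff i) * r ^ i = M

namespace IsGaussValue

open Polynomial

variable {F Γ : Type*} [Field F] [LinearOrderedCommGroupWithZero Γ] {v : Valuation F Γ} {r : Γ}

theorem C (a : F) : IsGaussValue v r (C a) (v a) where
  le i := by
    rw [coeff_C]
    split_ifs with h <;> simp [h]
  exists_eq := ⟨0, by simp⟩

theorem X_sub_C (a : F) : IsGaussValue v r (X - Polynomial.C a) (max r (v a)) where
  le i := by
    rcases i with _ | _ | i
    · simp
    · simp [coeff_X]
    · simp [coeff_X]
  exists_eq := by
    rcases le_total r (v a) with h | h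
    · exact ⟨0, by simp [h]⟩
    · exact ⟨1, by simp [h, coeff_X]⟩

/-- Gauss's lemma: Gauss values are multiplicative. -/
theorem mul (hr : r ≠ 0) {p q : F[X]} {M N : Γ} (hp : IsGaussValue v r p M)
    (hq : IsGaussValue v r q N) : IsGaussValue v r (p * q) (M * N) := by
  classical
  have hterm : ∀ i j, v (p.coeff i * q.coeff j) * r ^ (i + j) =
      (v (p.coeff i) * r ^ i) * (v (q.coeff j) * r ^ j) := fun i j => by
    rw [map_mul, pow_add]; exact mul_mul_mul_comm _ _ _ _
  have hle : ∀ n, v ((p * q).coeff n) * r ^ n ≤ M * N := by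
    intro n
    have hrn : 0 < r ^ n := zero_lt_iff.mpr (pow_ne_zero _ hr)
    rw [← le_div_iff₀ hrn, coeff_mul]
    refine v.map_sum_le fun x hx => ?_
    rw [le_div_iff₀ hrn, ← Finset.HasAntidiagonal.mem_antidiagonal.mp hx, hterm]
    exact mul_le_mul' (hp.le _) (hq.le _)
  refine ⟨hle, ?_⟩
  by_cases hMN : M * N = 0
  · exact ⟨0, le_antisymm (hle 0) (by rw [hMN]; exact zero_le)⟩
  have hM : M ≠ 0 := left_ne_zero_of_mul hMN
  have hN : N ≠ 0 := right_ne_zero_of_mul hMN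
  -- With `i` and `j` the least indices at which the maxima are attained, the term `pᵢ qⱼ` strictly
  -- dominates the coefficient of index `i + j` of the product.
  obtain ⟨i, hi, hi'⟩ : ∃ i, v (p.coeff i) * r ^ i = M ∧ ∀ j < i, v (p.coeff j) * r ^ j < M :=
    ⟨Nat.find hp.exists_eq, Nat.find_spec hp.exists_eq,
      fun j hj => lt_of_le_of_ne (hp.le j) (Nat.find_min hp.exists_eq hj)⟩
  obtain ⟨j, hj, hj'⟩ : ∃ i, v (q.coeff i) * r ^ i = N ∧ ∀ j < i, v (q.coeff j) * r ^ j < N :=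
    ⟨Nat.find hq.exists_eq, Nat.find_spec hq.exists_eq,
      fun j hj => lt_of_le_of_ne (hq.le j) (Nat.find_min hq.exists_eq hj)⟩
  refine ⟨i + j, ?_⟩
  have hrn : 0 < r ^ (i + j) := zero_lt_iff.mpr (pow_ne_zero _ hr)
  have hmem : (i, j) ∈ Finset.HasAntidiagonal.antidiagonal (i + j) := by simp
  have hmain : v (p.coeff i * q.coeff j) = M * N / r ^ (i + j) := by
    rw [eq_div_iff hrn.ne', hterm, hi, hj]
  have hrest : v (∑ x ∈ (Finset.HasAntidiagonal.antidiagonal (i + j)).erase (i, j),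
      p.coeff x.1 * q.coeff x.2) < M * N / r ^ (i + j) := by
    refine v.map_sum_lt (div_ne_zero hMN hrn.ne') fun x hx => ?_
    obtain ⟨hne, hx⟩ := Finset.mem_erase.mp hx
    have hsum : x.1 + x.2 = i + j := Finset.HasAntidiagonal.mem_antidiagonal.mp hx
    rw [lt_div_iff₀ hrn, ← hsum, hterm]
    rcases lt_trichotomy x.1 i with h | h | h
    · calc _ ≤ (v (p.coeff x.1) * r ^ x.1) * N := mul_le_mul_right (hq.le _) _
        _ < M * N := mul_lt_mul_of_pos_right (hi' _ h) (zero_lt_iff.mpr hN)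
    · exact absurd (Prod.ext h (by simp; omega)) hne
    · have h2 : x.2 < j := by omega
      calc _ ≤ M * (v (q.coeff x.2) * r ^ x.2) := mul_le_mul_left (hp.le _) _
        _ < M * N := mul_lt_mul_of_pos_left (hj' _ h2) (zero_lt_iff.mpr hM)
  rw [coeff_mul, ← Finset.add_sum_erase _ _ hmem, v.map_add_eq_of_lt_left (by rwa [hmain]), hterm,
    hi, hj]

theorem prod (hr : r ≠ 0) {ι : Type*} (s : Finset ι) {p : ι → F[X]} {M : ι → Γ}
    (h : ∀ i ∈ s, IsGaussValue v r (p i) (M i)) :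
    IsGaussValue v r (∏ i ∈ s, p i) (∏ i ∈ s, M i) := by
  classical
  induction s using Finset.induction_on with
  | empty => simpa using C (v := v) (r := r) 1
  | insert i s hi ih =>
    rw [Finset.prod_insert hi, Finset.prod_insert hi]
    exact (h i (by simp)).mul hr (ih fun j hj => h j (by simp [hj]))

/-- The generic value on the disc of radius `r` about `β` of a polynomial with roots `α i`. -/
theorem comp_X_add_C (hr : r ≠ 0) {ι : Type*} (s : Finset ι) (a : F) (α : ι → F) (β : F) :
    IsGaussValue v r
      ((Polynomial.C a * ∏ i ∈ s, (X - Polynomial.C (α i))).comp (X + Polynomial.C β))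
      (v a * ∏ i ∈ s, max r (v (α i - β))) := by
  have h : (Polynomial.C a * ∏ i ∈ s, (X - Polynomial.C (α i))).comp (X + Polynomial.C β) =
      Polynomial.C a * ∏ i ∈ s, (X - Polynomial.C (α i - β)) := by
    rw [mul_comp, C_comp, prod_comp]
    congr 1
    refine Finset.prod_congr rfl fun i _ => ?_
    simp only [sub_comp, X_comp, C_comp, C_sub]
    ring
  rw [h]
  exact (C a).mul hr (prod hr s fun i _ => X_sub_C _)

end IsGaussValue

/-! ### Descent through discs -/

open Finset in
/-- The open balls of radius `r` partition the points `α i`, and at least two of them are needed.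
As there is at most one point `c k` fewer, and each lies in one of these balls, some ball contains
at least as many points `c k` as points `α i`. -/
theorem exists_ball_card_le_card {F ι κ Γ : Type*} [Field F] [LinearOrderedCommGroupWithZero Γ]
    (v : Valuation F Γ) {α : ι → F} {c : κ → F} {A : Finset ι} {C : Finset κ} {r : Γ} (hr : r ≠ 0)
    (hcard : #A ≤ #C + 1) (hfar : ∃ i ∈ A, ∃ j ∈ A, r ≤ v (α i - α j))
    (hnear : ∀ k ∈ C, ∃ i ∈ A, v (c k - α i) < r) :
    ∃ i ∈ A, #{j ∈ A | v (α j - α i) < r} ≤ #{k ∈ C | v (c k - α i) < r} := by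
  classical
  by_contra! hcon
  -- The quotient of `F` by this relation is the set of open balls of radius `r`.
  let S : Setoid F :=
    { r := fun x y => v (x - y) < r
      iseqv :=
        ⟨fun x => by simpa using zero_lt_iff.mpr hr,
        fun {x y} h => by rwa [v.map_sub_swap],
        fun {x y z} h₁ h₂ => by
          have := v.map_add_lt h₁ h₂
          rwa [sub_add_sub_cancel] at this⟩ }
  let q : F → Quotient S := Quotient.mk S
  have hq : ∀ x y, q x = q y ↔ v (x - y) < r := fun x y => Quotient.eq (r := S)
  let T : Finset (Quotient S) := A.image fun i => q (α i)
  have hA : #A = ∑ t ∈ T, #{i ∈ A | q (α i) = t} :=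
    card_eq_sum_card_fiberwise fun i hi => mem_image_of_mem _ hi
  have hC : #C = ∑ t ∈ T, #{k ∈ C | q (c k) = t} := by
    refine card_eq_sum_card_fiberwise fun k hk => ?_
    obtain ⟨i, hi, h⟩ := hnear k hk
    exact mem_image.mpr ⟨i, hi, ((hq _ _).mpr h).symm⟩
  have hT : 2 ≤ #T := by
    obtain ⟨i, hi, j, hj, h⟩ := hfar
    exact one_lt_card.mpr ⟨q (α i), mem_image_of_mem _ hi, q (α j), mem_image_of_mem _ hj,
      fun h' => h.not_gt ((hq _ _).mp h')⟩
  have hlt : ∑ t ∈ T, (#{k ∈ C | q (c k) = t} + 1) ≤ ∑ t ∈ T, #{i ∈ A | q (α i) = t} := by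
    refine sum_le_sum fun t ht => ?_
    obtain ⟨i, hi, rfl⟩ := mem_image.mp ht
    simpa only [hq] using Nat.succ_le_of_lt (hcon i hi)
  rw [sum_add_distrib, ← hA, ← hC, sum_const, smul_eq_mul, mul_one] at hlt
  omega

open Finset in
/-- Let `G = a ∏ |z - αᵢ|` have generic value larger than `1` on the disc of radius `r` spanned by
the points `α i`, and let `H = b ∏ |z - cₖ|` have a generic value there which is at most that of `G`. If
`G ≤ 1` at all `c k`, and there is at most one `c k` fewer than points `α i`, then around some
`α i` there is a smaller disc, of radius `s`, on which `G` has generic value `1` and `H` has generic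
value at most `1`.

A residue class of the disc that contains at least as many points `c k` as points `α i` has the
property that, on shrinking the radius, `H` decreases at least as fast as `G`. So `H ≤ G` persists
down to the disc spanned by the points `α i` in the class, where the argument is repeated,
until `G` has reached `1`. -/
theorem exists_radius_prod_max {F ι κ Γ : Type*} [Field F] [LinearOrderedCommGroupWithZero Γ]
    (v : Valuation F Γ) (hroot : ∀ x : Γ, ∀ n ≠ 0, ∃ y, y ^ n = x) (α : ι → F) (c : κ → F)
    (A : Finset ι) (C : Finset κ) (r a b : Γ) (hab : b * r ^ #C ≤ a * r ^ #A)
    (ha : 1 < a * r ^ #A) (hr : r ≠ 0) (hcard : #A ≤ #C + 1)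
    (hdiam : ∀ i ∈ A, ∀ j ∈ A, v (α i - α j) ≤ r) (hfar : ∃ i ∈ A, ∃ j ∈ A, r ≤ v (α i - α j))
    (hc : ∀ k ∈ C, a * ∏ i ∈ A, v (c k - α i) ≤ 1) :
    ∃ i ∈ A, ∃ s, s ≠ 0 ∧ s < r ∧ a * ∏ j ∈ A, max s (v (α j - α i)) = 1 ∧
      b * ∏ k ∈ C, max s (v (c k - α i)) ≤ 1 := by
  classical
  induction A using Finset.strongInduction generalizing C r a b with
  | H A ih =>
  have hr0 : 0 < r := zero_lt_iff.mpr hr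
  have ha0 : a ≠ 0 := by rintro rfl; simp at ha
  have hnear : ∀ k ∈ C, ∃ i ∈ A, v (c k - α i) < r := by
    intro k hk
    by_contra! h
    refine ((ha.trans_le ?_).trans_le (hc k hk)).false
    refine mul_le_mul_right ?_ a
    rw [← prod_const]
    exact prod_le_prod' h
  obtain ⟨i₀, hi₀, hi₀card⟩ := exists_ball_card_le_card v hr hcard hfar hnear
  set A' := {j ∈ A | v (α j - α i₀) < r} with hA'
  set C' := {k ∈ C | v (c k - α i₀) < r} with hC'
  have hA'A : A' ⊆ A := filter_subset _ _
  have hC'C : C' ⊆ C := filter_subset _ _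
  have hi₀' : i₀ ∈ A' := by simp [hA', hi₀, hr0]
  have hne : A'.Nonempty := ⟨i₀, hi₀'⟩
  have hcard0 : #A' ≠ 0 := hne.card_pos.ne'
  have hssub : A' ⊂ A := by
    refine hA'A.ssubset_of_ne fun h => ?_
    obtain ⟨i, hi, j, hj, hij⟩ := hfar
    rw [← h] at hi hj
    have h1 := (mem_filter.mp hi).2
    have h2 := (mem_filter.mp hj).2
    have := v.map_sub_lt h1 h2
    rw [sub_sub_sub_cancel_right] at this
    exact hij.not_gt this
  have hAA : ∀ i ∈ A', ∀ j ∈ A', v (α i - α j) < r := by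
    intro i hi j hj
    have := v.map_sub_lt (mem_filter.mp hi).2 (mem_filter.mp hj).2
    rwa [sub_sub_sub_cancel_right] at this
  have hout : ∀ x, v (x - α i₀) < r → ∀ j ∈ A \ A', v (x - α j) = r := by
    intro x hx j hj
    obtain ⟨hj, hj'⟩ := mem_sdiff.mp hj
    have h1 : v (α j - α i₀) = r :=
      le_antisymm (hdiam j hj i₀ hi₀) (not_lt.mp fun h => hj' (mem_filter.mpr ⟨hj, h⟩))
    rw [← sub_sub_sub_cancel_right x (α j) (α i₀), v.map_sub_eq_of_lt_right (by rwa [h1]), h1]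
  have houtC : ∀ i ∈ A', ∀ k ∈ C, v (c k - α i) ≤ r := by
    intro i hi k hk
    obtain ⟨j, hj, h⟩ := hnear k hk
    have := v.map_add_le h.le (hdiam j hj i (hA'A hi))
    rwa [sub_add_sub_cancel] at this
  -- The factors of `G` and `H` that belong to points outside the class are at most `r` on it, and
  -- equal to `r` in the case of `G`; they are absorbed into the constants.
  set a' := a * r ^ #(A \ A') with ha'
  set b' := b * r ^ #(C \ C') with hb'
  have ha'r : a' * r ^ #A' = a * r ^ #A := by
    rw [ha', mul_assoc, ← pow_add, card_sdiff_add_card_eq_card hA'A]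
  have hb'r : b' * r ^ #C' = b * r ^ #C := by
    rw [hb', mul_assoc, ← pow_add, card_sdiff_add_card_eq_card hC'C]
  have ha'0 : a' ≠ 0 := mul_ne_zero ha0 (pow_ne_zero _ hr)
  have hab' : ∀ s ≤ r, b' * s ^ #C' ≤ a' * s ^ #A' := by
    intro s hs
    obtain ⟨m, hm⟩ := Nat.exists_eq_add_of_le hi₀card
    have h1 : b' * r ^ m ≤ a' := by
      have := hab
      rw [← ha'r, ← hb'r, hm, pow_add, mul_comm (r ^ _) (r ^ m), ← mul_assoc] at this
      exact le_of_mul_le_mul_right this (zero_lt_iff.mpr (pow_ne_zero _ hr))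
    calc b' * s ^ #C' = b' * s ^ m * s ^ #A' := by
          rw [hm, pow_add, mul_comm (s ^ _) (s ^ m), ← mul_assoc]
      _ ≤ a' * s ^ #A' :=
        mul_le_mul_left ((mul_le_mul_right (pow_le_pow_left' hs m) _).trans h1) _
  have hc' : ∀ k ∈ C', a' * ∏ i ∈ A', v (c k - α i) ≤ 1 := by
    intro k hk
    have h := hc k (hC'C hk)
    rw [← prod_sdiff hA'A, prod_congr rfl (hout _ (mem_filter.mp hk).2), prod_const,
      ← mul_assoc] at h
    exact h
  suffices H : ∃ i ∈ A', ∃ s, s ≠ 0 ∧ s < r ∧ a' * ∏ j ∈ A', max s (v (α j - α i)) = 1 ∧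
      b' * ∏ k ∈ C', max s (v (c k - α i)) ≤ 1 by
    obtain ⟨i, hi, s, hs0, hsr, h1, h2⟩ := H
    refine ⟨i, hA'A hi, s, hs0, hsr, ?_, le_trans ?_ h2⟩
    · rw [← prod_sdiff hA'A, ← h1, ha', ← mul_assoc]
      congr 2
      refine prod_eq_pow_card fun j hj => ?_
      rw [v.map_sub_swap, hout _ (mem_filter.mp hi).2 j hj, max_eq_right hsr.le]
    · rw [← prod_sdiff hC'C, hb', ← mul_assoc]
      refine mul_le_mul_left (mul_le_mul_right ?_ b) _
      exact prod_le_pow_card _ _ _ fun k hk =>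
        max_le hsr.le (houtC i hi k (mem_sdiff.mp hk).1)
  obtain ⟨⟨i₁, j₁⟩, hmem, hmax⟩ := exists_max_image (A' ×ˢ A') (fun p => v (α p.1 - α p.2))
    (hne.product hne)
  obtain ⟨hi₁, hj₁⟩ := mem_product.mp hmem
  set r' := v (α i₁ - α j₁) with hr'
  have hr'r : r' < r := hAA _ hi₁ _ hj₁
  have hdiam' : ∀ i ∈ A', ∀ j ∈ A', v (α i - α j) ≤ r' := fun i hi j hj =>
    hmax (i, j) (mem_product.mpr ⟨hi, hj⟩)
  rcases lt_or_ge 1 (a' * r' ^ #A') with hlt | hge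
  · -- `G` still exceeds `1` on the disc spanned by the points of the class.
    have hr'0 : r' ≠ 0 := by
      intro h
      rw [h, zero_pow hcard0, mul_zero] at hlt
      exact not_lt_zero hlt
    obtain ⟨i, hi, s, hs0, hsr, h⟩ := ih A' hssub C' r' a' b' (hab' _ hr'r.le) hlt hr'0
      (by omega) hdiam' ⟨i₁, hi₁, j₁, hj₁, le_rfl⟩ hc'
    exact ⟨i, hi, s, hs0, hsr.trans hr'r, h⟩
  · -- `G` reaches the value `1` on a disc that contains all points `α i` of the class; by `hc'` it
    -- then contains all points `c k` of the class as well.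
    obtain ⟨s, hs⟩ := hroot a'⁻¹ #A' hcard0
    have hs1 : a' * s ^ #A' = 1 := by rw [hs, mul_inv_cancel₀ ha'0]
    have hs0 : s ≠ 0 := by
      rintro rfl
      rw [zero_pow hcard0, mul_zero] at hs1
      exact zero_ne_one hs1
    have hmono : ∀ x y : Γ, a' * x ^ #A' < a' * y ^ #A' → x < y := fun x y h =>
      lt_of_pow_lt_pow_left' _ (lt_of_mul_lt_mul_left' h)
    have hsr : s < r := hmono _ _ (by rwa [hs1, ha'r])
    have hr's : r' ≤ s := not_lt.mp fun h => by
      have h1 : s ^ #A' < r' ^ #A' := pow_lt_pow_left₀ h zero_le hcard0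
      have := mul_lt_mul_of_pos_left h1 (zero_lt_iff.mpr ha'0)
      rw [hs1] at this
      exact this.not_ge hge
    refine ⟨i₀, hi₀', s, hs0, hsr, ?_, ?_⟩
    · rw [prod_eq_pow_card (b := s), hs1]
      exact fun j hj => max_eq_left ((hdiam' j hj i₀ hi₀').trans hr's)
    · rw [prod_eq_pow_card (b := s)]
      · exact (hab' s hsr.le).trans hs1.le
      intro k hk
      refine max_eq_left (not_lt.mp fun h => ?_)
      have heq : ∀ j ∈ A', v (c k - α j) = v (c k - α i₀) := by
        intro j hj
        rw [← sub_sub_sub_cancel_right (c k) (α j) (α i₀), v.map_sub_eq_of_lt_left]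
        exact ((hdiam' j hj i₀ hi₀').trans hr's).trans_lt h
      have h2 := hc' k hk
      rw [prod_eq_pow_card heq] at h2
      have h1 : s ^ #A' < v (c k - α i₀) ^ #A' := pow_lt_pow_left₀ h zero_le hcard0
      have := mul_lt_mul_of_pos_left h1 (zero_lt_iff.mpr ha'0)
      rw [hs1] at this
      exact this.not_ge h2

/-! ### Affine conjugates of a polynomial over an algebraically closed valued field -/

namespace Polynomial

section Dynamics

variable {F Γ : Type*} [Field F] [LinearOrderedCommGroupWithZero Γ]

theorem exists_eq_C_mul_prod_X_sub_C [IsAlgClosed F] {p : F[X]} {n : ℕ}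
    (hn : p.natDegree = n) : ∃ α : Fin n → F, p = C p.leadingCoeff * ∏ i, (X - C (α i)) := by
  have h := (IsAlgClosed.splits p).eq_prod_roots
  subst hn
  have hlen : p.roots.toList.length = p.natDegree := by
    rw [Multiset.length_toList, (IsAlgClosed.splits p).natDegree_eq_card_roots]
  refine ⟨fun i => p.roots.toList.get (i.cast hlen.symm), ?_⟩
  conv_lhs => rw [h]
  congr 1
  conv_lhs => rw [← Multiset.coe_toList p.roots, Multiset.map_coe, Multiset.prod_coe,
    ← List.ofFn_get p.roots.toList, List.map_ofFn, List.prod_ofFn]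
  exact Fintype.prod_equiv (finCongr hlen) _ _ fun i => rfl

/-- If the fixed points of `f` span a disc of radius `ρ` and `f - X` has generic value larger than
`ρ` on it, then a point `c` with `v (f c - c) > ρ` escapes: from `f c` on, the distance of the orbit
to a fixed point is strictly increasing. -/
theorem infinite_orbit_of_lt {ι : Type*} [Fintype ι] (v : Valuation F Γ) {a : F} {α : ι → F}
    {f : F[X]} (hf : f - X = C a * ∏ i, (X - C (α i))) {ρ : Γ} (i₀ : ι)
    (hρ : ∀ i, v (α i - α i₀) ≤ ρ) (hι : Fintype.card ι ≠ 0)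
    (ha : ρ < v a * ρ ^ Fintype.card ι) {c : F} (hc : ρ < v ((f - X).eval c)) :
    (Set.range fun n : ℕ => (fun z => f.eval z)^[n] c).Infinite := by
  have hg : ∀ z, v ((f - X).eval z) = v a * ∏ i, v (z - α i) := by
    intro z
    simp [hf, eval_prod]
  have hρ0 : ρ ≠ 0 := by
    rintro rfl
    simp [hι] at ha
  obtain ⟨m, hm⟩ := Nat.exists_eq_succ_of_ne_zero hι
  have ha' : 1 < v a * ρ ^ m := by
    rw [hm, pow_succ, ← mul_assoc] at ha
    by_contra h
    exact ha.not_ge (mul_le_of_le_one_left' (not_lt.mp h))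
  have hsub : ∀ z, f.eval z - α i₀ = (f - X).eval z + (z - α i₀) := by
    intro z; simp
  have hstep : ∀ z, ρ < v (z - α i₀) → v (z - α i₀) < v (f.eval z - α i₀) := by
    intro z hz
    have hz' : ∀ i, v (z - α i) = v (z - α i₀) := by
      intro i
      rw [← sub_sub_sub_cancel_right z (α i) (α i₀), v.map_sub_eq_of_lt_left]
      exact (hρ i).trans_lt hz
    have hgz : v (z - α i₀) < v ((f - X).eval z) := by
      rw [hg, Finset.prod_congr rfl fun i _ => hz' i, Finset.prod_const, Finset.card_univ, hm,
        pow_succ, ← mul_assoc]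
      have h1 : 1 < v a * v (z - α i₀) ^ m :=
        ha'.trans_le (mul_le_mul_right (pow_le_pow_left' hz.le m) _)
      calc v (z - α i₀) = 1 * v (z - α i₀) := (one_mul _).symm
        _ < _ := mul_lt_mul_of_pos_right h1 (zero_le.trans_lt hz)
    rwa [hsub, v.map_add_eq_of_lt_left hgz]
  have hfirst : ρ < v (f.eval c - α i₀) := by
    rcases lt_or_ge ρ (v (c - α i₀)) with h | h
    · exact h.trans (hstep c h)
    · rwa [hsub, v.map_add_eq_of_lt_left (h.trans_lt hc)]
  set φ : F → F := fun z => f.eval z with hφ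
  have hlarge : ∀ n, ρ < v (φ^[n + 1] c - α i₀) := by
    intro n
    induction n with
    | zero => exact hfirst
    | succ n ih =>
      rw [Function.iterate_succ_apply']
      exact ih.trans (hstep _ ih)
  have hmono : StrictMono fun n => v (φ^[n + 1] c - α i₀) :=
    strictMono_nat_of_lt_succ fun n => by
      rw [Function.iterate_succ_apply' φ (n + 1)]
      exact hstep _ (hlarge n)
  have hinj : Function.Injective fun n => φ^[n + 1] c := fun m n h =>
    hmono.injective (congrArg (fun z => v (z - α i₀)) h)
  refine (Set.infinite_range_of_injective hinj).mono ?_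
  rintro _ ⟨n, rfl⟩
  exact ⟨n + 1, rfl⟩

/-- The coefficients of the conjugate of `f` by `z ↦ α + b z`, in terms of those of `f - X` centred
at `α`. -/
theorem coeff_affine_conj (f : F[X]) (α : F) {b : F} (hb : b ≠ 0) (j : ℕ) :
    (C b⁻¹ * (f.comp (C b * X + C α) - C α)).coeff j =
      (X : F[X]).coeff j + b⁻¹ * (((f - X).comp (X + C α)).coeff j * b ^ j) := by
  have h : C b⁻¹ * (f.comp (C b * X + C α) - C α) =
      X + C b⁻¹ * ((f - X).comp (X + C α)).comp (C b * X) := by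
    have h1 : C b⁻¹ * C b = (1 : F[X]) := by rw [← C_mul, inv_mul_cancel₀ hb, C_1]
    rw [comp_assoc]
    simp only [sub_comp, X_comp, add_comp, C_comp]
    linear_combination X * h1
  rw [h, coeff_add, coeff_C_mul, comp_C_mul_X_coeff]

theorem coeff_succ_affine_conj (f : F[X]) (α : F) {b : F} (hb : b ≠ 0) (j : ℕ) :
    (C b⁻¹ * (f.comp (C b * X + C α) - C α)).coeff (j + 1) =
      (f.comp (X + C α)).coeff (j + 1) * b ^ j := by
  rw [coeff_affine_conj f α hb, sub_comp, X_comp, coeff_sub, coeff_add, coeff_C_succ, pow_succ]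
  rcases j with _ | j
  · field_simp
    simp
  · rw [coeff_X_of_ne_one (by omega)]
    field_simp
    simp

/-- If `f - X` has generic value at most the radius on the disc spanned by the fixed points, then
`f` is conjugate to a polynomial with integral coefficients whose leading coefficient is a unit. -/
theorem exists_integral_affine_conj_of_le [IsAlgClosed F] (v : Valuation F Γ) {f : F[X]} {d : ℕ}
    (hd : f.natDegree = d) (hd2 : 2 ≤ d) {α : Fin d → F}
    (hα : f - X = C f.leadingCoeff * ∏ i, (X - C (α i))) (i₀ : Fin d)
    (hle : ∀ i, v f.leadingCoeff * v (α i - α i₀) ^ (d - 1) ≤ 1) :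
    ∃ b : F, b ≠ 0 ∧
      (∀ j, v ((C b⁻¹ * (f.comp (C b * X + C (α i₀)) - C (α i₀))).coeff j) ≤ 1) ∧
      v ((C b⁻¹ * (f.comp (C b * X + C (α i₀)) - C (α i₀))).coeff d) = 1 := by
  have ha0 : f.leadingCoeff ≠ 0 := leadingCoeff_ne_zero.mpr <| by
    rintro rfl
    rw [natDegree_zero] at hd
    omega
  obtain ⟨b, hb⟩ := IsAlgClosed.exists_pow_nat_eq f.leadingCoeff⁻¹ (n := d - 1) (by omega)
  have hab : f.leadingCoeff * b ^ (d - 1) = 1 := by rw [hb, mul_inv_cancel₀ ha0]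
  have hb0 : b ≠ 0 := by
    rintro rfl
    rw [zero_pow (by omega), mul_zero] at hab
    exact zero_ne_one hab
  have hvb : v b ≠ 0 := (Valuation.ne_zero_iff v).mpr hb0
  have hvab : v f.leadingCoeff * v b ^ (d - 1) = 1 := by rw [← map_pow, ← map_mul, hab, map_one]
  have hdist : ∀ i, v (α i - α i₀) ≤ v b := by
    intro i
    by_contra h
    have h1 := pow_lt_pow_left₀ (not_le.mp h) zero_le (n := d - 1) (by omega)
    have := mul_lt_mul_of_pos_left h1
      (zero_lt_iff.mpr ((Valuation.ne_zero_iff v).mpr ha0))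
    rw [hvab] at this
    exact this.not_ge (hle i)
  refine ⟨b, hb0, fun j => ?_, ?_⟩
  · have hG := (IsGaussValue.comp_X_add_C (v := v) hvb Finset.univ f.leadingCoeff α (α i₀)).le j
    rw [← hα, Finset.prod_eq_pow_card (b := v b) (fun i _ => max_eq_left (hdist i)),
      Finset.card_univ, Fintype.card_fin] at hG
    have hpow : v b ^ d = v b ^ (d - 1) * v b := by rw [← pow_succ, Nat.sub_add_cancel (by omega)]
    rw [hpow, ← mul_assoc, hvab, one_mul] at hG
    rw [coeff_affine_conj f _ hb0]
    refine v.map_add_le ?_ ?_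
    · rw [coeff_X]
      split_ifs <;> simp
    · rw [map_mul, map_mul, map_pow, map_inv₀]
      calc (v b)⁻¹ * _ ≤ (v b)⁻¹ * v b := mul_le_mul_right hG _
        _ = 1 := inv_mul_cancel₀ hvb
  · obtain ⟨m, rfl⟩ : ∃ m, d = m + 1 := ⟨d - 1, by omega⟩
    have hco : (f.comp (X + C (α i₀))).coeff (m + 1) = f.leadingCoeff := by
      have h1 : (f.comp (X + C (α i₀))).natDegree = m + 1 := by
        rw [natDegree_comp, natDegree_X_add_C, mul_one, hd]
      rw [← h1, coeff_natDegree, leadingCoeff_comp (by simp)]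
      simp
    rw [coeff_succ_affine_conj f _ hb0, hco, map_mul, map_pow]
    exact hvab

/-- If `|f'| ≤ 1` on a disc about the fixed point `α` whose image under `f` is strictly larger than
the disc, then `f` has an integral conjugate whose reduction has degree at least `2` and is wildly
ramified at `∞`. -/
theorem exists_integral_affine_conj_of_radius [IsAlgClosed F] (v : Valuation F Γ) {f : F[X]} {α : F}
    (hα : f.eval α = α) {s : Γ}
    (hder : ∀ j, v ((derivative f |>.comp (X + C α)).coeff j) * s ^ j ≤ 1)
    (hexp : ∃ j, s < v (((f - X).comp (X + C α)).coeff j) * s ^ j) :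
    ∃ b : F, b ≠ 0 ∧
      (∀ j, v ((C b⁻¹ * (f.comp (C b * X + C α) - C α)).coeff j) ≤ 1) ∧
      (∃ j, 2 ≤ j ∧ v ((C b⁻¹ * (f.comp (C b * X + C α) - C α)).coeff j) = 1) ∧
      ∀ j, 2 ≤ j → v (j * (C b⁻¹ * (f.comp (C b * X + C α) - C α)).coeff j) < 1 := by
  classical
  set p := f.comp (X + C α) with hp
  have hder' : ∀ j : ℕ, v ((j + 1 : ℕ) * p.coeff (j + 1)) * s ^ j ≤ 1 := by
    intro j
    have : derivative p = (derivative f).comp (X + C α) := by simp [hp, derivative_comp]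
    have h := hder j
    rw [← this, coeff_derivative] at h
    rwa [mul_comm (p.coeff _), ← Nat.cast_add_one] at h
  have hgp : (f - X).comp (X + C α) = p - (X + C α) := by simp [hp]
  have hp1 : v (p.coeff 1) ≤ 1 := by simpa using hder' 0
  have hp0 : p.coeff 0 = α := by simp [hp, coeff_zero_eq_eval_zero, eval_comp, hα]
  obtain ⟨j₀, hj₀⟩ := hexp
  rw [hgp] at hj₀
  rcases j₀ with _ | _ | m
  · simp [hp0] at hj₀
  · simp only [zero_add, pow_one, coeff_sub, coeff_add, coeff_X_one, coeff_C_succ, add_zero] at hj₀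
    exact absurd (mul_le_of_le_one_left' (v.map_sub_le hp1 (by simp))) hj₀.not_ge
  have hpm : 1 < v (p.coeff (m + 2)) * s ^ (m + 1) := by
    rw [coeff_sub, coeff_add, coeff_C_succ, coeff_X_of_ne_one (by omega), add_zero, sub_zero,
      pow_succ, ← mul_assoc] at hj₀
    by_contra h
    exact hj₀.not_ge (mul_le_of_le_one_left' (not_lt.mp h))
  -- `v (β j)` is the largest value of `b` for which the coefficient `pⱼ b ^ (j - 1)` is integral.
  -- The smallest of these makes the whole conjugate integral.
  let J : Finset ℕ := {j ∈ p.support | 2 ≤ j}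
  have hJ : ∀ j, j ∈ J ↔ p.coeff j ≠ 0 ∧ 2 ≤ j := by intro j; simp [J]
  have hmJ : m + 2 ∈ J := by
    refine (hJ _).mpr ⟨?_, by omega⟩
    intro h
    simp [h] at hpm
  have hβ : ∀ j, ∃ β : F, 2 ≤ j → β ^ (j - 1) = (p.coeff j)⁻¹ := by
    intro j
    by_cases hj : 2 ≤ j
    · obtain ⟨β, h⟩ := IsAlgClosed.exists_pow_nat_eq (p.coeff j)⁻¹ (n := j - 1) (by omega)
      exact ⟨β, fun _ => h⟩
    · exact ⟨0, fun h => absurd h hj⟩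
  choose β hβ using hβ
  have hβ1 : ∀ j ∈ J, v (p.coeff j) * v (β j) ^ (j - 1) = 1 := by
    intro j hj
    obtain ⟨h0, h2⟩ := (hJ j).mp hj
    rw [← map_pow, ← map_mul, hβ j h2, mul_inv_cancel₀ h0, map_one]
  obtain ⟨k, hkJ, hkmin⟩ := J.exists_min_image (fun j => v (β j)) ⟨_, hmJ⟩
  have hk2 := ((hJ k).mp hkJ).2
  have hvb : v (β k) ≠ 0 := by
    intro h
    have := hβ1 k hkJ
    rw [h, zero_pow (by omega), mul_zero] at this
    exact zero_ne_one this
  have hb0 : β k ≠ 0 := (Valuation.ne_zero_iff v).mp hvb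
  have hbs : v (β k) < s := by
    refine (hkmin _ hmJ).trans_lt ?_
    have h := hβ1 _ hmJ
    rw [show m + 2 - 1 = m + 1 by omega] at h
    rw [← h] at hpm
    exact lt_of_pow_lt_pow_left' _ (lt_of_mul_lt_mul_left' hpm)
  have hu : ∀ j, (C (β k)⁻¹ * (f.comp (C (β k) * X + C α) - C α)).coeff (j + 1) =
      p.coeff (j + 1) * β k ^ j := coeff_succ_affine_conj f α hb0
  refine ⟨β k, hb0, ?_, ⟨k, hk2, ?_⟩, ?_⟩
  · rintro (_ | _ | j)
    · simp [coeff_zero_eq_eval_zero, eval_comp, hα]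
    · rw [hu]
      simpa using hp1
    · rw [hu, map_mul, map_pow]
      by_cases hj : j + 2 ∈ J
      · rw [← hβ1 _ hj]
        exact mul_le_mul_right (pow_le_pow_left' (hkmin _ hj) _) _
      · have : p.coeff (j + 2) = 0 := by
          by_contra h
          exact hj ((hJ _).mpr ⟨h, by omega⟩)
        simp [this]
  · obtain ⟨l, rfl⟩ : ∃ l, k = l + 1 := ⟨k - 1, by omega⟩
    rw [hu, map_mul, map_pow]
    exact hβ1 _ hkJ
  · intro j hj
    obtain ⟨l, rfl⟩ : ∃ l, j = l + 1 := ⟨j - 1, by omega⟩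
    rw [hu, ← mul_assoc, map_mul, map_pow]
    by_cases h0 : v ((l + 1 : ℕ) * p.coeff (l + 1)) = 0
    · rw [h0, zero_mul]
      exact zero_lt_one
    · exact (mul_lt_mul_of_pos_left (pow_lt_pow_left₀ hbs zero_le (by omega))
        (zero_lt_iff.mpr h0)).trans_le (hder' l)

/-- A postcritically finite polynomial of degree nonzero in the field has an integral affine
conjugate whose reduction either has full degree or is wildly ramified at `∞`. -/
theorem exists_integral_affine_conj [IsAlgClosed F] (v : Valuation F Γ)
    (hv : Function.Surjective v) (f : F[X]) (hd : 2 ≤ f.natDegree) (hdF : (f.natDegree : F) ≠ 0)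
    (hdv : v (f.natDegree : F) ≤ 1)
    (hpcf : ∀ c, (derivative f).eval c = 0 →
      (Set.range fun n : ℕ => (fun z => f.eval z)^[n] c).Finite) :
    ∃ α b : F, b ≠ 0 ∧
      (∀ j, v ((C b⁻¹ * (f.comp (C b * X + C α) - C α)).coeff j) ≤ 1) ∧
      (v ((C b⁻¹ * (f.comp (C b * X + C α) - C α)).coeff f.natDegree) = 1 ∨
        (∃ j, 2 ≤ j ∧ v ((C b⁻¹ * (f.comp (C b * X + C α) - C α)).coeff j) = 1) ∧
        ∀ j, 2 ≤ j → v (j * (C b⁻¹ * (f.comp (C b * X + C α) - C α)).coeff j) < 1) := by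
  have hroot : ∀ x : Γ, ∀ n ≠ 0, ∃ y, y ^ n = x := by
    intro x n hn
    obtain ⟨z, rfl⟩ := hv x
    obtain ⟨y, hy⟩ := IsAlgClosed.exists_pow_nat_eq z (Nat.pos_of_ne_zero hn)
    exact ⟨v y, by rw [← map_pow, hy]⟩
  generalize hd' : f.natDegree = d at *
  set a := f.leadingCoeff with ha'
  have hf0 : f ≠ 0 := by
    rintro rfl
    rw [natDegree_zero] at hd'
    omega
  have ha0 : a ≠ 0 := leadingCoeff_ne_zero.mpr hf0
  have hva0 : v a ≠ 0 := (Valuation.ne_zero_iff v).mpr ha0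
  have hXdeg : (X : F[X]).natDegree < f.natDegree := by
    rw [natDegree_X]
    omega
  have hgdeg : (f - X).natDegree = d := by
    rw [natDegree_sub_eq_left_of_natDegree_lt hXdeg, hd']
  have hglead : (f - X).leadingCoeff = a :=
    leadingCoeff_sub_of_degree_lt (degree_lt_degree hXdeg)
  have hdercoeff : (derivative f).coeff (d - 1) = d * a := by
    rw [coeff_derivative, Nat.sub_add_cancel (by omega), mul_comm, ← Nat.cast_add_one,
      Nat.sub_add_cancel (by omega), ha', leadingCoeff, hd']
  have hderdeg : (derivative f).natDegree = d - 1 :=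
    natDegree_eq_of_le_of_coeff_ne_zero (hd' ▸ natDegree_derivative_le f)
      (by rw [hdercoeff]; exact mul_ne_zero hdF ha0)
  have hderlead : (derivative f).leadingCoeff = d * a := by
    rw [leadingCoeff, hderdeg, hdercoeff]
  obtain ⟨α, hα⟩ := exists_eq_C_mul_prod_X_sub_C hgdeg
  obtain ⟨c, hc⟩ := exists_eq_C_mul_prod_X_sub_C hderdeg
  rw [hglead] at hα
  rw [hderlead] at hc
  have hfix : ∀ i, f.eval (α i) = α i := by
    intro i
    have h : (f - X).eval (α i) = 0 := by
      rw [hα, eval_mul, eval_prod, Finset.prod_eq_zero (Finset.mem_univ i) (by simp), mul_zero]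
    simpa [sub_eq_zero] using h
  obtain ⟨⟨i₁, j₁⟩, -, hmax⟩ := Finset.univ.exists_max_image
    (fun p : Fin d × Fin d => v (α p.1 - α p.2)) ⟨(⟨0, by omega⟩, ⟨0, by omega⟩), by simp⟩
  set ρ := v (α i₁ - α j₁) with hρ
  have hdiam : ∀ i j, v (α i - α j) ≤ ρ := fun i j => hmax (i, j) (Finset.mem_univ _)
  rcases le_or_gt (v a * ρ ^ (d - 1)) 1 with hle | hlt
  · obtain ⟨b, hb0, hb, hbd⟩ := exists_integral_affine_conj_of_le v hd' hd hα i₁ fun i =>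
      (mul_le_mul_right (pow_le_pow_left' (hdiam _ _) _) _).trans hle
    exact ⟨α i₁, b, hb0, hb, Or.inl hbd⟩
  have hρ0 : ρ ≠ 0 := by
    intro h
    rw [h, zero_pow (by omega), mul_zero] at hlt
    exact not_lt_zero hlt
  have hpow : v a * ρ ^ d = v a * ρ ^ (d - 1) * ρ := by
    rw [mul_assoc, ← pow_succ, Nat.sub_add_cancel (by omega)]
  have hexp : ρ < v a * ρ ^ d := by
    rw [hpow]
    calc ρ = 1 * ρ := (one_mul _).symm
      _ < _ := mul_lt_mul_of_pos_right hlt (zero_lt_iff.mpr hρ0)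
  have hcrit : ∀ k, v ((f - X).eval (c k)) ≤ ρ := by
    intro k
    by_contra h
    refine infinite_orbit_of_lt v hα i₁ (fun i => hdiam i i₁) ?_ ?_ (not_le.mp h) (hpcf (c k) ?_)
    · rw [Fintype.card_fin]
      omega
    · rwa [Fintype.card_fin]
    · rw [hc, eval_mul, eval_prod, Finset.prod_eq_zero (Finset.mem_univ k) (by simp), mul_zero]
  -- The descent is applied to `|f - X| / ρ` and `|f'|`.
  obtain ⟨i, -, s, hs0, hsρ, h1, h2⟩ := exists_radius_prod_max v hroot α c Finset.univ Finset.univ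
    ρ (v a / ρ) (v (d * a))
    (by
      rw [Finset.card_univ, Finset.card_univ, Fintype.card_fin, Fintype.card_fin,
        div_mul_eq_mul_div, hpow, mul_div_cancel_right₀ _ hρ0, map_mul]
      exact mul_le_mul_left (mul_le_of_le_one_left' hdv) _)
    (by
      rwa [Finset.card_univ, Fintype.card_fin, div_mul_eq_mul_div, hpow,
        mul_div_cancel_right₀ _ hρ0])
    hρ0
    (by
      rw [Finset.card_univ, Finset.card_univ, Fintype.card_fin, Fintype.card_fin]
      omega)
    (fun i _ j _ => hdiam i j) ⟨i₁, Finset.mem_univ _, j₁, Finset.mem_univ _, le_rfl⟩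
    (by
      intro k _
      have h := hcrit k
      rw [hα, eval_mul, eval_prod, eval_C, map_mul, map_prod] at h
      rw [div_mul_eq_mul_div]
      refine div_le_one_of_le₀ ?_ zero_le
      simpa using h)
  obtain ⟨b, hb0, hb, hb'⟩ := exists_integral_affine_conj_of_radius v (hfix i)
    (by
      rw [hc]
      intro j
      exact ((IsGaussValue.comp_X_add_C (v := v) hs0 Finset.univ _ c (α i)).le j).trans h2)
    (by
      obtain ⟨j, hj⟩ := (IsGaussValue.comp_X_add_C (v := v) hs0 Finset.univ a α (α i)).exists_eq
      refine ⟨j, ?_⟩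
      rw [div_mul_eq_mul_div, div_eq_one_iff_eq hρ0] at h1
      rwa [hα, hj, h1])
  exact ⟨α i, b, hb0, hb, Or.inr hb'⟩

end Dynamics

end Polynomial

/-! ### Pairs of forms attached to polynomials -/

namespace Polynomial

/-- The pair of forms `[yⁿ p (x / y) : yⁿ]` of degree `n`. The degree is a parameter, since
reduction may lower the degree of `p`. -/
noncomputable def homogenizePair {R : Type*} [CommRing R] (p : R[X]) (n : ℕ) : FormPair R :=
  ![p.homogenize n, MvPolynomial.X 1 ^ n]

theorem toFormPair_eq_homogenizePair {K : Type*} [Field K] (f : K[X]) :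
    f.toFormPair = f.homogenizePair f.natDegree := by
  have h : f.homogenize f.natDegree = ∑ i ∈ Finset.range (f.natDegree + 1),
      MvPolynomial.C (f.coeff i) * MvPolynomial.X 0 ^ i *
        MvPolynomial.X 1 ^ (f.natDegree - i) := by
    conv_lhs => enter [1]; rw [f.as_sum_range_C_mul_X_pow]
    rw [homogenize_finsetSum]
    refine Finset.sum_congr rfl fun i hi => ?_
    rw [homogenize_C_mul, homogenize_X_pow (Nat.lt_succ_iff.mp (Finset.mem_range.mp hi)), mul_assoc]
  rw [homogenizePair, h]
  rfl

theorem map_homogenizePair {R S : Type*} [CommRing R] [CommRing S] (φ : R →+* S) (p : R[X])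
    (n : ℕ) : (p.homogenizePair n).map φ = (p.map φ).homogenizePair n := by
  funext i
  fin_cases i
  · simp [FormPair.map, homogenizePair, homogenize_map]
  · simp [FormPair.map, homogenizePair]

/-- The value of the homogenization at `∞ = (1, 0)`. -/
theorem eval_homogenize_one_zero {R : Type*} [CommRing R] (p : R[X]) (n : ℕ) {P : Fin 2 → R}
    (h0 : P 0 = 1) (h1 : P 1 = 0) : MvPolynomial.eval P (p.homogenize n) = p.coeff n := by
  rw [homogenize, map_sum, Finset.sum_eq_single (n, 0)]
  · simp [MvPolynomial.eval_monomial, Finsupp.prod_fintype, h0]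
  · rintro ⟨i, j⟩ hij hne
    have hj : j ≠ 0 := by
      rintro rfl
      simp at hij
      exact hne (by rw [hij])
    simp [MvPolynomial.eval_monomial, Finsupp.prod_fintype, h0, h1, hj]
  · simp

theorem homogenize_comp_affine {L : Type*} [Field L] {f : L[X]} {n : ℕ} (hn : f.natDegree ≤ n)
    (a b : L) {l : Fin 2 → MvPolynomial (Fin 2) L}
    (h0 : l 0 = MvPolynomial.C b * MvPolynomial.X 0 + MvPolynomial.C a * MvPolynomial.X 1)
    (h1 : l 1 = MvPolynomial.X 1) :
    (f.comp (C b * X + C a)).homogenize n = MvPolynomial.bind₁ l (f.homogenize n) := by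
  refine homogenize_eq_of_isHomogeneous ?_ ?_
  · have hl : ∀ i, (l i).IsHomogeneous 1 := by
      intro i
      fin_cases i
      · simp only [Fin.zero_eta, h0]
        exact (MvPolynomial.isHomogeneous_C_mul_X _ _).add (MvPolynomial.isHomogeneous_C_mul_X _ _)
      · simp only [Fin.mk_one, h1]
        exact MvPolynomial.isHomogeneous_X _ _
    simpa using (isHomogeneous_homogenize f (n := n)).aeval l hl
  · rw [MvPolynomial.aeval_bind₁, aeval_homogenize_of_eq_one hn]
    · simp [h0, comp, aeval_def]
    · simp [h1]

/-- An affine conjugate of `f` with integral coefficients yields an integral model; it is normalized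
because its second form is `yⁿ`. -/
theorem isIntegralModel_homogenizePair {L : Type*} [Field L] {V : ValuationSubring L} {f : L[X]}
    {n : ℕ} (hn : f.natDegree ≤ n) {a b : L} (hb : b ≠ 0) {U : V[X]}
    (hU : U.map V.subtype = C b⁻¹ * (f.comp (C b * X + C a) - C a)) :
    (U.homogenizePair n).IsIntegralModel (f.homogenizePair n) := by
  refine ⟨⟨⟨!![b, a; 0, 1], !![b⁻¹, -(b⁻¹ * a); 0, 1], ?_, ?_⟩, 1, one_ne_zero, ?_⟩, 1, ?_⟩
  · simp [Matrix.one_fin_two, hb]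
  · simp [Matrix.one_fin_two, hb]
  · have hsub : (C b⁻¹ * (f.comp (C b * X + C a) - C a)).homogenize n =
        MvPolynomial.C b⁻¹ * ((f.comp (C b * X + C a)).homogenize n -
          MvPolynomial.C a * MvPolynomial.X 1 ^ n) := by
      rw [homogenize_C_mul, ← homogenize_C, ← homogenizeLM_apply, ← homogenizeLM_apply,
        ← homogenizeLM_apply, map_sub]
    intro i
    rw [map_homogenizePair, hU]
    fin_cases i
    · have hcomp := homogenize_comp_affine hn a b 
        (l := fun l => MvPolynomial.C (!![b, a; 0, 1] l 0) * MvPolynomial.X 0 +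
          MvPolynomial.C (!![b, a; 0, 1] l 1) * MvPolynomial.X 1)
        (by simp) (by simp)
      simp [homogenizePair, FormPair.conj, Fin.sum_univ_two, hsub, hcomp]
      ring
    · simp [homogenizePair, FormPair.conj, Fin.sum_univ_two]
  · simp [FormPair.reduction, FormPair.map, homogenizePair]

theorem isRelPrime_homogenize_X_one_pow {k : Type*} [Field k] {p : k[X]} {n : ℕ}
    (hp : p.coeff n ≠ 0) (m : ℕ) :
    IsRelPrime (p.homogenize n) (MvPolynomial.X 1 ^ m : MvPolynomial (Fin 2) k) := by
  have hX : Irreducible (MvPolynomial.X 1 : MvPolynomial (Fin 2) k) :=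
    MvPolynomial.X_prime.irreducible
  refine IsRelPrime.pow_right (IsRelPrime.symm (hX.isRelPrime_iff_not_dvd.mpr ?_))
  rintro ⟨q, hq⟩
  have h := congrArg (MvPolynomial.eval ![1, 0]) hq
  rw [eval_homogenize_one_zero p n rfl rfl] at h
  exact hp (by simpa using h)

/-- The common factor of the pair of forms of degree `n` attached to a polynomial of lower
degree. -/
theorem homogenizePair_eq_mul {R : Type*} [CommRing R] (p : R[X]) {n : ℕ} (hn : p.natDegree ≤ n)
    (i : Fin 2) : p.homogenizePair n i =
      MvPolynomial.X 1 ^ (n - p.natDegree) * p.homogenizePair p.natDegree i := by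
  fin_cases i
  · have h := homogenize_mul (1 : R[X]) p (m := n - p.natDegree) (n := p.natDegree) (by simp) le_rfl
    rw [one_mul, Nat.sub_add_cancel hn, homogenize_one] at h
    exact h
  · change MvPolynomial.X 1 ^ n = MvPolynomial.X 1 ^ (n - p.natDegree) *
      MvPolynomial.X 1 ^ p.natDegree
    rw [← pow_add, Nat.sub_add_cancel hn]

/-- The ramification index at `∞` of a polynomial is its degree. -/
theorem natCast_ne_zero_of_isTamelyRamified {k : Type*} [Field k] {p : k[X]} {n : ℕ}
    (hp : p.coeff n ≠ 0) (h : (p.homogenizePair n).IsTamelyRamified) (hn : n ≠ 0) :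
    (n : k) ≠ 0 := by
  refine h ![1, 0] (by simp) n ?_
  rw [map_homogenizePair]
  set q := p.map (algebraMap k (AlgebraicClosure k)) with hq
  have hqn : q.coeff n ≠ 0 := by rw [hq, coeff_map]; simpa using hp
  have h1 : FormPair.pointForm (![1, 0] : Fin 2 → AlgebraicClosure k) = -MvPolynomial.X 1 := by
    simp [FormPair.pointForm]
  have h2 : FormPair.fibreForm (q.homogenizePair n) (![1, 0] : Fin 2 → AlgebraicClosure k) =
      -(MvPolynomial.C (q.coeff n) * MvPolynomial.X 1 ^ n) := by
    have h0 := eval_homogenize_one_zero q n (P := ![1, 0]) rfl rfl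
    simp [FormPair.fibreForm, homogenizePair, h0, hn]
  have hu : IsUnit (MvPolynomial.C (q.coeff n) : MvPolynomial (Fin 2) (AlgebraicClosure k)) :=
    (IsUnit.mk0 _ hqn).map MvPolynomial.C
  have hX : Prime (MvPolynomial.X 1 : MvPolynomial (Fin 2) (AlgebraicClosure k)) :=
    MvPolynomial.X_prime
  rw [h1, h2, emultiplicity_neg, emultiplicity_eq_of_associated_left (Associated.refl
      (MvPolynomial.X 1 : MvPolynomial (Fin 2) (AlgebraicClosure k))).neg_right,
    emultiplicity_eq_of_associated_right (associated_unit_mul_left _ _ hu),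
    emultiplicity_pow_self_of_prime hX]

end Polynomial

/-! ### Models over finite extensions -/

open Polynomial in
/-- An integral affine conjugate of `f` over the algebraic closure gives an integral model over the
finite extension generated by the coefficients of the coordinate change. -/
theorem exists_isIntegralModel_homogenizePair {K : Type*} [Field K] (f : K[X])
    (V : ValuationSubring (AlgebraicClosure K)) {a b : AlgebraicClosure K} (hb : b ≠ 0)
    {u : (AlgebraicClosure K)[X]}
    (hu : u = C b⁻¹ * ((f.map (algebraMap K (AlgebraicClosure K))).comp (C b * X + C a) - C a))
    (hint : ∀ j, V.valuation (u.coeff j) ≤ 1) :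
    ∃ (L : IntermediateField K (AlgebraicClosure K)) (_ : FiniteDimensional K L)
      (U : (V.comap (algebraMap L (AlgebraicClosure K)))[X]),
      (∀ j, algebraMap L (AlgebraicClosure K) (U.coeff j) = u.coeff j) ∧
      U.natDegree ≤ f.natDegree ∧
      (U.homogenizePair f.natDegree).IsIntegralModel (f.toFormPair.map (algebraMap K L)) := by
  let L := IntermediateField.adjoin K {a, b}
  have : FiniteDimensional K L := by
    refine IntermediateField.finiteDimensional_adjoin fun x _ => Algebra.IsIntegral.isIntegral x
  let a' : L := ⟨a, IntermediateField.subset_adjoin K _ (by simp)⟩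
  let b' : L := ⟨b, IntermediateField.subset_adjoin K _ (by simp)⟩
  have hb' : b' ≠ 0 := fun h => hb (congrArg Subtype.val h)
  let u' : L[X] := C b'⁻¹ * ((f.map (algebraMap K L)).comp (C b' * X + C a') - C a')
  have hu' : u'.map (algebraMap L (AlgebraicClosure K)) = u := by
    have ha : algebraMap L (AlgebraicClosure K) a' = a := rfl
    have hbb : algebraMap L (AlgebraicClosure K) b' = b := rfl
    simp only [u', hu, Polynomial.map_mul, Polynomial.map_sub, Polynomial.map_comp, map_C,
      Polynomial.map_add, map_X, map_inv₀, ha, hbb, Polynomial.map_map,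
      ← IsScalarTower.algebraMap_eq]
  have hlift : u' ∈ lifts (V.comap (algebraMap L (AlgebraicClosure K))).subtype := by
    rw [lifts_iff_coeff_lifts]
    intro j
    refine ⟨⟨u'.coeff j, ?_⟩, rfl⟩
    rw [ValuationSubring.mem_comap, ← V.valuation_le_one_iff, ← coeff_map, hu']
    exact hint j
  obtain ⟨U, hU⟩ := (mem_lifts _).mp hlift
  have hUdeg : U.natDegree ≤ f.natDegree := by
    rw [← natDegree_map_eq_of_injective (ValuationSubring.subtype_injective _) U, hU]
    refine (natDegree_C_mul_le _ _).trans ?_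
    rw [natDegree_sub_C, natDegree_comp, natDegree_map]
    calc _ ≤ f.natDegree * 1 := Nat.mul_le_mul_left _ natDegree_linear_le
      _ = _ := mul_one _
  refine ⟨L, this, U, fun j => ?_, hUdeg, ?_⟩
  · rw [← hu', ← hU, coeff_map, coeff_map]
    rfl
  · rw [toFormPair_eq_homogenizePair, map_homogenizePair]
    exact isIntegralModel_homogenizePair (natDegree_map_le) hb' hU

/-! ### Good reduction -/

theorem mainTheorem6 {K : Type*} [Field K] [ValuativeRel K] [TopologicalSpace K]
    [IsNonarchimedeanLocalField K] (f : Polynomial K) (hd : 2 ≤ f.natDegree)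
    (hpcf : f.IsPostcriticallyFinite) (hatr : IsAbsolutelyTamelyRamified f.toFormPair) :
    HasGoodReduction f.toFormPair := by
  have hf0 : f ≠ 0 := by
    rintro rfl
    simp at hd
  have hdK : (f.natDegree : K) ≠ 0 := by
    have h := hatr.1
    rw [Polynomial.toFormPair_eq_homogenizePair] at h
    exact Polynomial.natCast_ne_zero_of_isTamelyRamified (by simpa using hf0) h (by omega)
  obtain ⟨V, hV⟩ := ((ValuativeRel.valuation K).valuationSubring).exists_comap_algebraMap_eq
    (F := AlgebraicClosure K)
  have hdeg : (f.map (algebraMap K (AlgebraicClosure K))).natDegree = f.natDegree :=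
    Polynomial.natDegree_map _
  obtain ⟨a, b, hb, hint, hcases⟩ := Polynomial.exists_integral_affine_conj V.valuation
    V.valuation_surjective (f.map (algebraMap K (AlgebraicClosure K))) (by rwa [hdeg])
    (by rw [hdeg]; simpa using (algebraMap K (AlgebraicClosure K)).injective.ne hdK)
    ((V.valuation_le_one_iff _).mpr (natCast_mem V _))
    (by
      intro c hc
      rw [Polynomial.derivative_map, Polynomial.eval_map_algebraMap] at hc
      simpa only [Polynomial.eval_map_algebraMap] using hpcf c hc)
  rw [hdeg] at hcases
  generalize hu : Polynomial.C b⁻¹ * ((f.map (algebraMap K (AlgebraicClosure K))).comp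
    (Polynomial.C b * Polynomial.X + Polynomial.C a) - Polynomial.C a) = u at hint hcases
  obtain ⟨L, hL, U, hU, hUdeg, hmodel⟩ :=
    exists_isIntegralModel_homogenizePair f V hb hu.symm hint
  have hover : IsIntegersOver K (V.comap (algebraMap L (AlgebraicClosure K))) := by
    rw [IsIntegersOver, ValuationSubring.comap_comap, ← IsScalarTower.algebraMap_eq, hV]
  set R := U.map (IsLocalRing.residue _) with hR
  have hred : (U.homogenizePair f.natDegree).reduction = R.homogenizePair f.natDegree :=
    Polynomial.map_homogenizePair _ _ _
  have hRcoeff : ∀ j, R.coeff j ≠ 0 ↔ V.valuation (u.coeff j) = 1 := by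
    intro j
    rw [hR, Polynomial.coeff_map, V.residue_comap_ne_zero_iff, hU]
  refine ⟨L, inferInstance, inferInstance, hL, _, hover, _, hmodel, ?_⟩
  rw [hred]
  rcases hcases with h | ⟨⟨j, hj2, hj⟩, hwild⟩
  · exact Polynomial.isRelPrime_homogenize_X_one_pow ((hRcoeff _).mpr h) _
  · -- The reduction has degree `δ ≥ 2`, and `δ` times its leading coefficient is zero.
    exfalso
    have hRdeg : R.natDegree ≤ f.natDegree := (Polynomial.natDegree_map_le).trans hUdeg
    have hδ : 2 ≤ R.natDegree :=
      hj2.trans (Polynomial.le_natDegree_of_ne_zero ((hRcoeff j).mpr hj))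
    have hR0 : R ≠ 0 := by
      rintro h
      rw [h] at hδ
      simp at hδ
    have hlead : R.coeff R.natDegree ≠ 0 := by simpa using hR0
    have htame := hatr.2 L _ hover _ hmodel _ (R.homogenizePair R.natDegree)
      (fun i => by rw [hred]; exact Polynomial.homogenizePair_eq_mul R hRdeg i)
      (Polynomial.isRelPrime_homogenize_X_one_pow hlead _)
    have hne := mul_ne_zero
      (Polynomial.natCast_ne_zero_of_isTamelyRamified hlead htame (by omega)) hlead
    rw [hR, Polynomial.coeff_map, ← map_natCast (IsLocalRing.residue _), ← map_mul,
      V.residue_comap_ne_zero_iff] at hne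
    refine (hwild _ hδ).ne ?_
    rw [← hU]
    simpa using hne
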